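/- **Setting.** Let $\Gamma$ be a lattice (a set of sites) and let $\mathcal A$ be a quantum spin lattice system on $\Gamma$: a unital $C^*$-algebra with unital $*$-subalgebras $\mathcal A(I)$, one for each finite $I\subset\Gamma$, such that each $\mathcal A(I)$ is isomorphic to a full matrix algebra, $\mathcal A(I\cup J)=\mathcal A(I)\otimes\mathcal A(J)$ for disjoint finite $I,J$ (the isomorphism $\mathcal A(I)\otimes\mathcal A(J)\to\mathcal A(I\cup J)$ being $a\otimes b\mapsto ab$), and $\bigcup_I\mathcal A(I)$ is norm dense in $\mathcal A$. For an arbitrary $J\subset\Gamma$ let $\mathcal A(J)$ be the norm closure of $\bigcup_{\Lambda\subset J,\ |\Lambda|<\infty}\mathcal A(\Lambda)$. For a state $\psi$ of $\mathcal A$ and finite $I$, let $S_I(\psi)=-\mathrm{Tr}(D\log D)$, where $D$ is the density matrix (with respect to the matrix trace $\mathrm{Tr}$) of the restriction of $\psi$ to $\mathcal A(I)$. For $J\subset I^c$, finite or infinite, define the conditional entropy and the mutual entropy by $$\widetilde S_{I|J}(\psi)=\inf_{\Lambda\subset J,\ |\Lambda|<\infty}\{S_{I\cup\Lambda}(\psi)-S_\Lambda(\psi)\},\qquad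 I_\psi(I:J)=S_I(\psi)-\widetilde S_{I|J}(\psi).$$ A potential $\Phi$ assigns to each finite $K\subset\Gamma$ a self-adjoint $\Phi(K)\in\mathcal A(K)$. Put $H_I=\sum_{K\subset I}\Phi(K)$, and assume that for every finite $I$ the surface energy $$H_{\partial I}=\sum_{K\cap I\neq\emptyset,\ K\cap I^c\neq\emptyset}\Phi(K)$$ exists in $\mathcal A$, as the norm limit of the sums restricted to $K\subset\Lambda$ as the finite regions $\Lambda$ increase to $\Gamma$. A state $\varphi$ satisfies local thermodynamical stability (LTS) for $\Phi$ at inverse temperature $\beta>0$ if, for every finite $I$, $\widetilde F_I(\varphi)\le\widetilde F_I(\psi)$ for all states $\psi$ of $\mathcal A$ that agree with $\varphi$ on $\mathcal A(I^c)$, where $\widetilde F_I(\psi)=\psi(H_I+H_{\partial I})-\frac1\beta\widetilde S_{I|I^c}(\psi)$. **Theorem (thermal area law).** Let the state $\varphi$ of $\mathcal A$ satisfy LTS for $\Phi$ at inverse temperature $\beta>0$. For every finite $A\subset\Gamma$ there is a unique state $\varphi_A\otimes\varphi_{A^c}$ of $\mathcal A$ with $(\varphi_A\otimes\varphi_{A^c})(XY)=\varphi(X)\varphi(Y)$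 for $X\in\mathcal A(A)$, $Y\in\mathcal A(A^c)$, and for every finite or infinite $B\subset A^c$, $$I_\varphi(A:B)\le I_\varphi(A:A^c)\le\beta\,(\varphi_A\otimes\varphi_{A^c}-\varphi)(H_{\partial A})\le 2\beta\|H_{\partial A}\|.$$ Moreover, let the sites be labelled by $\Gamma\cong\mathbb Z^\nu$ with $\nu\ge1$, and let finite regions $A$ tend to infinity in the sense of van Hove: for every $a\in\{1,2,\dots\}^\nu$, if $n_a^-(A)$ and $n_a^+(A)$ denote the numbers of cells of the partition of $\mathbb Z^\nu$ into the translates of the box $\prod_i[0,a_i)$ by $(n_ia_i)_i$, $n\in\mathbb Z^\nu$, that are contained in $A$ and that meet $A$, respectively, then $n_a^-(A)\to\infty$ and $n_a^-(A)/n_a^+(A)\to1$. If $\|H_{\partial A}\|/|A|\to0$ along these regions, then $I_\varphi(A:A^c)/|A|\to0$ along them. -/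

import Mathlib

open Filter Topology
open scoped TensorProduct ComplexOrder

noncomputable section

/-- A quantum spin lattice system on the lattice `Γ`, realized on the unital C⋆-algebra `𝒜`:
every finite region `I` carries a full matrix algebra `loc I ⊆ 𝒜` (a unital ⋆-subalgebra), the local
algebras of disjoint finite regions form tensor products inside `𝒜`, and the union of all local
algebras is norm dense in `𝒜`. -/
structure QuantumSpinSystem (Γ : Type*) [DecidableEq Γ] (𝒜 : Type*) [CStarAlgebra 𝒜] where
  /-- The algebra `𝒜(I)` of the finite region `I`. -/
  loc : Finset Γ → StarSubalgebra ℂ 𝒜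
  /-- The matrix dimension `n_I`. -/
  dim : Finset Γ → ℕ
  /-- An identification of `𝒜(I)` with the full matrix algebra of size `n_I`. -/
  iso : ∀ I, loc I ≃⋆ₐ[ℂ] Matrix (Fin (dim I)) (Fin (dim I)) ℂ
  /-- `𝒜(I ∪ J) = 𝒜(I) ⊗ 𝒜(J)` for disjoint `I`, `J`: multiplication in `𝒜` induces an isomorphism
  of algebras (so in particular `𝒜(I)` and `𝒜(J)` commute). -/
  tensor : ∀ I J, Disjoint I J → ∃ e : (loc I ⊗[ℂ] loc J) ≃ₐ[ℂ] loc (I ∪ J),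
    ∀ (a : loc I) (b : loc J), (e (a ⊗ₜ[ℂ] b) : 𝒜) = (a : 𝒜) * (b : 𝒜)
  /-- The local elements are norm dense. -/
  dense : Dense (⋃ I : Finset Γ, (loc I : Set 𝒜))

/-- A state: a positive linear functional, normalized at the unit. -/
structure CStarState (𝒜 : Type*) [CStarAlgebra 𝒜] extends 𝒜 →ₗ[ℂ] ℂ where
  nonneg : ∀ a : 𝒜, 0 ≤ toLinearMap (star a * a)
  map_one : toLinearMap 1 = 1

instance {𝒜 : Type*} [CStarAlgebra 𝒜] : CoeFun (CStarState 𝒜) (fun _ => 𝒜 → ℂ) :=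
  ⟨fun φ => φ.toLinearMap⟩

namespace QuantumSpinSystem

variable {Γ : Type*} [DecidableEq Γ] {𝒜 : Type*} [CStarAlgebra 𝒜]

/-- The C⋆-algebra `𝒜(J)` of an arbitrary (finite or infinite) region `J`, as a set: the norm
closure of the (directed) union of the algebras of the finite subregions of `J`. -/
def region (S : QuantumSpinSystem Γ 𝒜) (J : Set Γ) : Set 𝒜 :=
  closure (⋃ (Λ : Finset Γ) (_ : (Λ : Set Γ) ⊆ J), (S.loc Λ : Set 𝒜))

/-- The density matrix of the restriction of `ψ` to `𝒜(I)` with respect to the matrix trace `Tr`,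
that is, the matrix `D` with `ψ X = Tr (D X)` for all `X ∈ 𝒜(I)`. -/
def densityMatrix (S : QuantumSpinSystem Γ 𝒜) (ψ : CStarState 𝒜) (I : Finset Γ) :
    Matrix (Fin (S.dim I)) (Fin (S.dim I)) ℂ :=
  Matrix.of fun i j => ψ ((S.iso I).symm (Matrix.single j i 1) : 𝒜)

/-- The von Neumann entropy `S_I(ψ) = - Tr (D log D)`, with `D` the density matrix of `ψ` on `I`;
`Real.negMulLog x = - x log x` is applied through the functional calculus. -/
def entropy (S : QuantumSpinSystem Γ 𝒜) (ψ : CStarState 𝒜) (I : Finset Γ) : ℝ :=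
  (cfc Real.negMulLog (S.densityMatrix ψ I)).trace.re

/-- The conditional entropy of `ψ` on the finite region `I` given the region `J`: the infimum over
the finite `Λ ⊆ J` of `S_{I ∪ Λ}(ψ) - S_Λ(ψ)`, taken in the extended reals, where it always
exists. -/
def condEntropy (S : QuantumSpinSystem Γ 𝒜) (ψ : CStarState 𝒜) (I : Finset Γ) (J : Set Γ) :
    EReal :=
  ⨅ (Λ : Finset Γ) (_ : (Λ : Set Γ) ⊆ J),
    ((S.entropy ψ (I ∪ Λ) - S.entropy ψ Λ : ℝ) : EReal)

/-- The mutual entropy `I_ψ(I : J)` of a finite region `I` and a region `J` disjoint from it. -/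
def mutualEntropy (S : QuantumSpinSystem Γ 𝒜) (ψ : CStarState 𝒜) (I : Finset Γ) (J : Set Γ) :
    EReal :=
  (S.entropy ψ I : EReal) - S.condEntropy ψ I J

/-- A potential: a self-adjoint element of `𝒜(K)` for every finite region `K`. -/
structure Potential (S : QuantumSpinSystem Γ 𝒜) where
  val : Finset Γ → 𝒜
  selfAdjoint : ∀ K, IsSelfAdjoint (val K)
  mem_loc : ∀ K, val K ∈ S.loc K

/-- The inner local Hamiltonian `H_I`, the sum of `Φ(K)` over `K ⊆ I`. -/
def Potential.innerHamiltonian {S : QuantumSpinSystem Γ 𝒜} (Φ : S.Potential) (I : Finset Γ) : 𝒜 :=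
  ∑ K ∈ I.powerset, Φ.val K

/-- `H` is the surface energy `H_{∂I}`: the sum of `Φ(K)` over all finite `K` that meet both `I` and
its complement converges in norm to `H`, as the limit over the finite regions `Λ` (directed by
inclusion) of the sums over `K ⊆ Λ`. -/
def Potential.HasSurfaceEnergy {S : QuantumSpinSystem Γ 𝒜} (Φ : S.Potential) (I : Finset Γ)
    (H : 𝒜) : Prop :=
  Tendsto (fun Λ : Finset Γ =>
    ∑ K ∈ Λ.powerset with (K ∩ I).Nonempty ∧ (K \ I).Nonempty, Φ.val K) atTop (𝓝 H)

/-- The conditional free energy of `ψ` on `I`, for the potential `Φ` with surface energies `Hsurf`: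
the energy `ψ(H_I + H_{∂I})` (a real number) minus `1/β` times the conditional entropy of `ψ` on `I`
given the complement of `I`. -/
def condFreeEnergy (S : QuantumSpinSystem Γ 𝒜) (Φ : S.Potential) (Hsurf : Finset Γ → 𝒜) (β : ℝ)
    (I : Finset Γ) (ψ : CStarState 𝒜) : EReal :=
  ((ψ (Φ.innerHamiltonian I + Hsurf I)).re : EReal)
    - ((1 / β : ℝ) : EReal) * S.condEntropy ψ I (I : Set Γ)ᶜ

/-- Local thermodynamical stability: for every finite region `I`, the state `φ` minimizes the
conditional free energy on `I` among all states that agree with `φ` on `𝒜(Iᶜ)`. -/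
def IsLTS (S : QuantumSpinSystem Γ 𝒜) (Φ : S.Potential) (Hsurf : Finset Γ → 𝒜) (β : ℝ)
    (φ : CStarState 𝒜) : Prop :=
  ∀ (I : Finset Γ) (ψ : CStarState 𝒜), (∀ X ∈ S.region (I : Set Γ)ᶜ, ψ X = φ X) →
    S.condFreeEnergy Φ Hsurf β I φ ≤ S.condFreeEnergy Φ Hsurf β I ψ

/-- `ω` is the product state `φ_A ⊗ φ_{Aᶜ}` of the restrictions of `φ` to `𝒜(A)` and `𝒜(Aᶜ)`. -/
def IsProductState (S : QuantumSpinSystem Γ 𝒜) (φ : CStarState 𝒜) (A : Finset Γ)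
    (ω : CStarState 𝒜) : Prop :=
  ∀ X ∈ S.loc A, ∀ Y ∈ S.region (A : Set Γ)ᶜ, ω (X * Y) = φ X * φ Y

end QuantumSpinSystem

/-- The cell with index `n` of the partition of `ℤ^ν` into translates of the box
`{x | 0 ≤ x i < a i}`. -/
def latticeCell {ν : ℕ} (a : Fin ν → ℕ) (n : Fin ν → ℤ) : Set (Fin ν → ℤ) :=
  {x | ∀ i, n i * (a i : ℤ) ≤ x i ∧ x i < (n i + 1) * (a i : ℤ)}

/-- The number of cells that are contained in `Λ`. -/
def innerCells {ν : ℕ} (a : Fin ν → ℕ) (Λ : Set (Fin ν → ℤ)) : ℕ :=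
  {n | latticeCell a n ⊆ Λ}.ncard

/-- The number of cells that meet `Λ`. -/
def outerCells {ν : ℕ} (a : Fin ν → ℕ) (Λ : Set (Fin ν → ℤ)) : ℕ :=
  {n | (latticeCell a n ∩ Λ).Nonempty}.ncard

/-- The finite regions `A` tend to infinity in the sense of van Hove along the filter `l`, where the
sites are identified with `ℤ^ν` by `e`: for all box sizes `a`, the number of cells inside `A` tends
to infinity, and its ratio to the number of cells that meet `A` tends to one. -/
def IsVanHove {Γ : Type*} {ν : ℕ} (e : Γ ≃ (Fin ν → ℤ)) (l : Filter (Finset Γ)) : Prop :=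
  ∀ a : Fin ν → ℕ, (∀ i, 0 < a i) →
    Tendsto (fun A : Finset Γ => innerCells a (e '' (A : Set Γ))) l atTop ∧
    Tendsto (fun A : Finset Γ => (innerCells a (e '' (A : Set Γ)) : ℝ) /
      (outerCells a (e '' (A : Set Γ)) : ℝ)) l (𝓝 1)

end

/-! Stability is tested against one competitor, the product state ω = φ_A ⊗ φ_{Aᶜ}. It agrees with φ
on 𝒜(Aᶜ), so it is admissible, and on 𝒜(A), so the inner energies cancel. Entropy is additive on
products, so every term of the infimum defining the conditional entropy of ω is S_A(φ). Minimality
of φ then reads S_A(φ) - S̃ ≤ β (ω - φ)(H_∂A), with S̃ the conditional entropy of φ, and states have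
norm at most one. Monotonicity in B and nonnegativity are immediate from the infimum, without strong
subadditivity; the limit is a squeeze.

The work lies in ω: `exists_productState` builds it as a sum of compressions of φ, and
`IsProductState.entropy_union` factorizes its density matrices. The tensor structure is only an
abstract algebra isomorphism, so `Matrix.trace_mul_of_commute` recovers the product trace from
uniqueness of the trace. -/

namespace CStarState

/-! ### States: hermiticity and contractivity. -/

variable {𝒜 : Type*} [CStarAlgebra 𝒜] (φ : CStarState 𝒜)

theorem apply_star (a : 𝒜) : φ (star a) = star (φ a) := by
  -- Positivity at `a + c • 1` makes the expanded quadratic real; c = 0, 1, i then determine the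
  -- relation between φ(a) and φ(a*).
  have key (c : ℂ) : (φ (star a * a) + c * φ (star a) + star c * φ a + star c * c).im = 0 := by
    have h := (Complex.le_def.1 (φ.nonneg (a + c • 1))).2
    have e : star (a + c • (1 : 𝒜)) * (a + c • 1)
        = star a * a + c • star a + star c • a + (star c * c) • 1 := by
      simp only [star_add, star_smul, star_one, mul_add, add_mul, smul_mul_assoc, mul_smul_comm,
        one_mul, mul_one, smul_add, smul_smul, mul_comm]
      abel
    rw [e] at h
    simp only [map_add, map_smul, φ.map_one, smul_eq_mul, mul_one] at h
    simpa using h.symm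
  have h0 := key 0
  have h1 := key 1
  have h2 := key Complex.I
  simp at h0 h1 h2
  apply Complex.ext <;> simp <;> linarith

/-- The variance, the value at b* b for b = a - φ(a)1, is nonnegative. -/
theorem normSq_le (a : 𝒜) : ‖φ a‖ ^ 2 ≤ (φ (star a * a)).re := by
  have h := (Complex.le_def.1 (φ.nonneg (a - φ a • 1))).1
  have e : star (a - φ a • (1 : 𝒜)) * (a - φ a • 1)
      = star a * a - φ a • star a - star (φ a) • a + (star (φ a) * φ a) • 1 := by
    simp only [star_sub, star_smul, star_one, mul_sub, sub_mul, smul_mul_assoc, mul_smul_comm,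
      one_mul, mul_one, smul_sub, smul_smul, mul_comm]
    abel
  rw [e] at h
  simp only [map_add, map_sub, map_smul, φ.map_one, smul_eq_mul, mul_one, apply_star] at h
  simp at h
  rw [← Complex.normSq_eq_norm_sq, Complex.normSq_apply]
  linarith

/-- In the spectral order ‖a‖² - a* a is positive, hence of the form b* b, where the positivity of φ
applies. -/
theorem norm_apply_le (a : 𝒜) : ‖φ a‖ ≤ ‖a‖ := by
  let := CStarAlgebra.spectralOrder 𝒜
  have := CStarAlgebra.spectralOrderedRing 𝒜
  have h1 : (0 : 𝒜) ≤ algebraMap ℝ 𝒜 (‖a‖ ^ 2) - star a * a :=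
    sub_nonneg.2 CStarAlgebra.star_mul_le_algebraMap_norm_sq
  obtain ⟨b, hb⟩ := CStarAlgebra.nonneg_iff_eq_star_mul_self.1 h1
  have h2 := (Complex.le_def.1 (φ.nonneg b)).1
  have e : algebraMap ℝ 𝒜 (‖a‖ ^ 2) = ((‖a‖ ^ 2 : ℝ) : ℂ) • (1 : 𝒜) := by
    rw [Algebra.algebraMap_eq_smul_one, Complex.coe_smul]
  rw [← hb, e, map_sub, map_smul, φ.map_one] at h2
  have h3 := φ.normSq_le a
  have : ‖φ a‖ ^ 2 ≤ ‖a‖ ^ 2 := by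
    simp only [smul_eq_mul, mul_one, Complex.sub_re, Complex.ofReal_re, Complex.zero_re] at h2
    linarith
  exact le_of_sq_le_sq this (norm_nonneg _)

theorem continuous : Continuous φ :=
  (φ.toLinearMap.mkContinuous 1 fun a => by simpa using φ.norm_apply_le a).continuous

theorem ext_of_dense {s : Set 𝒜} (hs : Dense s) {φ ψ : CStarState 𝒜} (h : ∀ a ∈ s, φ a = ψ a) :
    φ = ψ := by
  have : φ.toLinearMap = ψ.toLinearMap :=
    LinearMap.ext fun a => congrFun (φ.continuous.ext_on hs ψ.continuous h) a
  cases φ; cases ψ; simp_all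

end CStarState

/-! ### Matrix traces, functional calculus and additivity of entropy. -/

section Matrix

variable {m n k : Type*} [Fintype m] [DecidableEq m] [Fintype n] [DecidableEq n]
  [Fintype k] [DecidableEq k]

open scoped MatrixOrder in
theorem Matrix.PosSemidef.exists_eq_star_mul_self {D : Matrix n n ℂ} (hD : D.PosSemidef) :
    ∃ C : Matrix n n ℂ, D = star C * C :=
  CStarAlgebra.nonneg_iff_eq_star_mul_self.1 hD.nonneg

/-- A tracial functional on a full matrix algebra is a multiple of the trace. -/
theorem Matrix.linearMap_eq_smul_trace_of_tracial (f : Matrix m m ℂ →ₗ[ℂ] ℂ)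
    (hf : ∀ X Y, f (X * Y) = f (Y * X)) (X : Matrix m m ℂ) :
    (Fintype.card m : ℂ) * f X = f 1 * X.trace := by
  have hoff (i j : m) (hij : i ≠ j) : f (single i j 1) = 0 := by
    have := hf (single i i 1) (single i j 1)
    simpa [hij, hij.symm] using this
  have hdiag (i j : m) : f (single i i 1) = f (single j j 1) := by
    simpa using hf (single i j 1) (single j i 1)
  have hone (i : m) : f 1 = Fintype.card m * f (single i i 1) := by
    have : (1 : Matrix m m ℂ) = ∑ j, single j j 1 := by
      rw [← Matrix.diagonal_one, ← Matrix.sum_single_eq_diagonal]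
    rw [this, map_sum, Finset.sum_congr rfl fun j _ => hdiag j i]
    simp
  conv_lhs => rw [X.matrix_eq_sum_single]
  simp only [map_sum]
  have h1 (i j : m) : f (single i j (X i j)) = if i = j then X i i * f (single i i 1) else 0 := by
    have : single i j (X i j) = X i j • single i j (1 : ℂ) := by simp
    rw [this, map_smul, smul_eq_mul]
    split_ifs with h
    · rw [h]
    · rw [hoff i j h, mul_zero]
  simp only [h1, Finset.sum_ite_eq, Finset.mem_univ, if_true, Matrix.trace, Matrix.diag,
    Finset.mul_sum]
  refine Finset.sum_congr rfl fun i _ => ?_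
  rw [hone i]; ring

/-- For fixed Y, X ↦ Tr(ι X κ Y) is tracial because κ Y commutes with the range of ι, so it is a
multiple of the trace; so is Y ↦ Tr(κ Y). The dimension count fixes the constants. -/
theorem Matrix.trace_mul_of_commute (ι : Matrix m m ℂ →⋆ₐ[ℂ] Matrix k k ℂ)
    (κ : Matrix n n ℂ →⋆ₐ[ℂ] Matrix k k ℂ) (hc : ∀ X Y, Commute (ι X) (κ Y))
    [Nonempty m] [Nonempty n] (hk : Fintype.card k = Fintype.card m * Fintype.card n)
    (X : Matrix m m ℂ) (Y : Matrix n n ℂ) :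
    (ι X * κ Y).trace = X.trace * Y.trace := by
  have h1 (Y) := Matrix.linearMap_eq_smul_trace_of_tracial
    ((Matrix.traceLinearMap k ℂ ℂ).comp ((LinearMap.mulRight ℂ (κ Y)).comp ι.toAlgHom.toLinearMap))
    (fun A B => by
      simp only [LinearMap.comp_apply, AlgHom.toLinearMap_apply, StarAlgHom.coe_toAlgHom, map_mul,
        LinearMap.mulRight_apply, Matrix.traceLinearMap_apply]
      rw [mul_assoc, Matrix.trace_mul_comm, mul_assoc, ← (hc A Y).eq]
      simp only [mul_assoc]) X
  have h2 := Matrix.linearMap_eq_smul_trace_of_tracial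
    ((Matrix.traceLinearMap k ℂ ℂ).comp κ.toAlgHom.toLinearMap)
    (fun A B => by
      simp only [LinearMap.comp_apply, AlgHom.toLinearMap_apply, StarAlgHom.coe_toAlgHom, map_mul,
        Matrix.traceLinearMap_apply]
      exact Matrix.trace_mul_comm _ _) Y
  simp only [LinearMap.comp_apply, AlgHom.toLinearMap_apply, StarAlgHom.coe_toAlgHom, map_one,
        LinearMap.mulRight_apply, Matrix.traceLinearMap_apply, one_mul, Matrix.trace_one, hk]
    at h1 h2
  have hm : (Fintype.card m : ℂ) ≠ 0 := by simp
  have hn : (Fintype.card n : ℂ) ≠ 0 := by simp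
  apply mul_left_cancel₀ hm
  apply mul_left_cancel₀ hn
  rw [h1]
  push_cast at h2
  linear_combination X.trace * h2

/-- The functional calculus of a matrix written in terms of a resolution of the identity. -/
theorem Matrix.cfc_sum_smul_idempotents (f : ℝ → ℝ) {e : k → Matrix n n ℂ}
    (he : CompleteOrthogonalIdempotents e) (hs : ∀ i, IsSelfAdjoint (e i)) (d : k → ℝ) :
    cfc f (∑ i, (d i : ℂ) • e i) = ∑ i, (f (d i) : ℂ) • e i := by
  set D := ∑ i, (d i : ℂ) • e i with hD
  have hDs : IsSelfAdjoint D := by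
    refine isSelfAdjoint_sum _ fun i _ => ?_
    rw [IsSelfAdjoint, star_smul, (hs i).star_eq]; simp
  have haev (q : Polynomial ℝ) : Polynomial.aeval D q = ∑ i, ((q.eval (d i) : ℝ) : ℂ) • e i := by
    induction q using Polynomial.induction_on' with
    | add p q hp hq => simp [hp, hq, add_smul, Finset.sum_add_distrib]
    | monomial r a =>
      have hpow : D ^ r = ∑ i, ((d i ^ r : ℝ) : ℂ) • e i := by
        induction r with
        | zero => simp [he.complete]
        | succ r ih =>
          rw [pow_succ, ih, hD, Finset.sum_mul_sum]
          refine Finset.sum_congr rfl fun i _ => ?_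
          simp only [smul_mul_smul_comm, he.mul_eq]
          simp [pow_succ]
      rw [Polynomial.aeval_monomial, hpow, Finset.mul_sum]
      refine Finset.sum_congr rfl fun i _ => ?_
      rw [Algebra.algebraMap_eq_smul_one, smul_mul_assoc, one_mul, Polynomial.eval_monomial,
        ← Complex.coe_smul, smul_smul]
      push_cast; rfl
  -- The polynomial with roots `d i` annihilates D, so the spectrum consists of some of the `d i`.
  have hspec : ∀ x ∈ spectrum ℝ D, ∃ i, d i = x := by
    intro x hx
    set q : Polynomial ℝ := ∏ i, (Polynomial.X - Polynomial.C (d i))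
    have hq : Polynomial.aeval D q = 0 := by
      rw [haev]
      refine Finset.sum_eq_zero fun i _ => ?_
      rw [Polynomial.eval_prod, Finset.prod_eq_zero (Finset.mem_univ i) (by simp)]
      simp
    have h0 : q.eval x ∈ spectrum ℝ (Polynomial.aeval D q) :=
      spectrum.subset_polynomial_aeval D q ⟨x, hx, rfl⟩
    have hne : Nontrivial (Matrix n n ℂ) := by
      by_contra h
      rw [not_nontrivial_iff_subsingleton] at h
      rw [spectrum.of_subsingleton] at hx
      exact hx
    rw [hq, spectrum.zero_eq, Set.mem_singleton_iff, Polynomial.eval_prod,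
      Finset.prod_eq_zero_iff] at h0
    obtain ⟨i, _, hi⟩ := h0
    exact ⟨i, by simpa [sub_eq_zero, eq_comm] using hi⟩
  -- Interpolating at all values `d i`, including any whose idempotent is zero, reduces the claim to
  -- polynomials; the image merges repeated values.
  set q : Polynomial ℝ := Lagrange.interpolate (Finset.univ.image d) id f
  have hqe (i : k) : q.eval (d i) = f (d i) :=
    Lagrange.eval_interpolate_at_node f Function.injective_id.injOn
      (Finset.mem_image_of_mem d (Finset.mem_univ i))
  rw [cfc_congr (g := q.eval) (fun x hx => by obtain ⟨i, rfl⟩ := hspec x hx; exact (hqe i).symm),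
    cfc_polynomial q D hDs, haev]
  simp only [hqe]

/-- The spectral theorem in terms of a resolution of the identity. -/
theorem Matrix.IsHermitian.exists_idempotents {D : Matrix n n ℂ} (hD : D.IsHermitian) :
    ∃ (e : n → Matrix n n ℂ) (d : n → ℝ), CompleteOrthogonalIdempotents e ∧
      (∀ i, IsSelfAdjoint (e i)) ∧ D = ∑ i, (d i : ℂ) • e i := by
  obtain ⟨U, d, hU, hU', h⟩ : ∃ (U : Matrix n n ℂ) (d : n → ℝ), star U * U = 1 ∧ U * star U = 1 ∧
      D = U * Matrix.diagonal (fun i => (d i : ℂ)) * star U :=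
    ⟨hD.eigenvectorUnitary, hD.eigenvalues, Unitary.coe_star_mul_self _,
      Unitary.coe_mul_star_self _, hD.spectral_theorem⟩
  have hmul (X Y : Matrix n n ℂ) : U * X * star U * (U * Y * star U) = U * (X * Y) * star U := by
    calc _ = U * X * (star U * U) * Y * star U := by simp only [mul_assoc]
      _ = _ := by rw [hU, mul_one, mul_assoc U]
  refine ⟨fun i => U * single i i 1 * star U, d,
    CompleteOrthogonalIdempotents.iff_ortho_complete.2 ⟨fun i j hij => ?_, ?_⟩, fun i => ?_, ?_⟩
  · simp only [hmul]
    simp [hij]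
  · rw [← Finset.sum_mul, ← Finset.mul_sum, Matrix.sum_single_eq_diagonal]
    simpa using hU'
  · rw [IsSelfAdjoint, star_mul, star_mul, star_star, star_eq_conjTranspose (single i i 1),
      Matrix.conjTranspose_single, star_one]
    exact (mul_assoc _ _ _).symm
  · rw [h, ← Matrix.sum_single_eq_diagonal, Finset.mul_sum, Finset.sum_mul]
    refine Finset.sum_congr rfl fun i _ => ?_
    rw [← smul_mul_assoc, ← mul_smul_comm, Matrix.smul_single, smul_eq_mul, mul_one]

/-- The von Neumann entropy is additive for tensor products of density matrices. -/
theorem Matrix.trace_cfc_negMulLog_mul (ι : Matrix m m ℂ →⋆ₐ[ℂ] Matrix k k ℂ)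
    (κ : Matrix n n ℂ →⋆ₐ[ℂ] Matrix k k ℂ) (hc : ∀ X Y, Commute (ι X) (κ Y))
    [Nonempty m] [Nonempty n] (hk : Fintype.card k = Fintype.card m * Fintype.card n)
    {X : Matrix m m ℂ} {Y : Matrix n n ℂ} (hX : X.IsHermitian) (hY : Y.IsHermitian)
    (hX1 : X.trace = 1) (hY1 : Y.trace = 1) :
    (cfc Real.negMulLog (ι X * κ Y)).trace =
      (cfc Real.negMulLog X).trace + (cfc Real.negMulLog Y).trace := by
  obtain ⟨e, p, he, hes, hXe⟩ := hX.exists_idempotents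
  obtain ⟨g, q, hg, hgs, hYg⟩ := hY.exists_idempotents
  have htr (A B) : (ι A * κ B).trace = A.trace * B.trace :=
    Matrix.trace_mul_of_commute ι κ hc hk A B
  have hP : CompleteOrthogonalIdempotents fun x : m × n => ι (e x.1) * κ (g x.2) := by
    refine CompleteOrthogonalIdempotents.iff_ortho_complete.2 ⟨fun x y hxy => ?_, ?_⟩
    · show ι (e x.1) * κ (g x.2) * (ι (e y.1) * κ (g y.2)) = 0
      rw [Commute.mul_mul_mul_comm (hc _ _).symm, ← map_mul, ← map_mul]
      by_cases h1 : x.1 = y.1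
      · rw [hg.ortho (fun h2 => hxy (Prod.ext h1 h2)), map_zero, mul_zero]
      · rw [he.ortho h1, map_zero, zero_mul]
    · rw [Fintype.sum_prod_type]
      dsimp only
      rw [← Finset.sum_mul_sum, ← map_sum, ← map_sum, he.complete,
        hg.complete, map_one, map_one, one_mul]
  have hPs (x : m × n) : IsSelfAdjoint (ι (e x.1) * κ (g x.2)) := by
    rw [IsSelfAdjoint, star_mul, ← map_star, ← map_star, (hes _).star_eq, (hgs _).star_eq,
      (hc _ _).eq]
  have hprod : ι X * κ Y = ∑ x : m × n, ((p x.1 * q x.2 : ℝ) : ℂ) • (ι (e x.1) * κ (g x.2)) := by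
    rw [hXe, hYg, map_sum, map_sum, Finset.sum_mul_sum, Fintype.sum_prod_type]
    simp only [map_smul, smul_mul_smul_comm, Complex.ofReal_mul]
  rw [hprod, Matrix.cfc_sum_smul_idempotents _ hP hPs]
  have hX1' : ∑ i, (p i : ℂ) * (e i).trace = 1 := by
    rw [← hX1, hXe]; simp [Matrix.trace_sum]
  have hY1' : ∑ i, (q i : ℂ) * (g i).trace = 1 := by
    rw [← hY1, hYg]; simp [Matrix.trace_sum]
  rw [hXe, hYg, Matrix.cfc_sum_smul_idempotents _ he hes, Matrix.cfc_sum_smul_idempotents _ hg hgs]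
  simp only [Matrix.trace_sum, Matrix.trace_smul, htr, smul_eq_mul]
  -- With η(x) = -x log x, η(pq) = q η(p) + p η(q), also at zero; the two unit traces remove the
  -- extra factors.
  calc _ = (∑ i, (Real.negMulLog (p i) : ℂ) * (e i).trace) * (∑ j, (q j : ℂ) * (g j).trace)
        + (∑ i, (p i : ℂ) * (e i).trace) * (∑ j, (Real.negMulLog (q j) : ℂ) * (g j).trace) := by
        rw [Finset.sum_mul_sum, Finset.sum_mul_sum, ← Finset.sum_add_distrib,
          Fintype.sum_prod_type]
        refine Finset.sum_congr rfl fun i _ => ?_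
        rw [← Finset.sum_add_distrib]
        refine Finset.sum_congr rfl fun j _ => ?_
        rw [Real.negMulLog_mul]
        push_cast; ring
    _ = _ := by rw [hX1', hY1']; ring

end Matrix

/-! ### Local algebras: isotony, commutation, dimensions. -/

namespace QuantumSpinSystem

variable {Γ : Type*} [DecidableEq Γ] {𝒜 : Type*} [CStarAlgebra 𝒜] (S : QuantumSpinSystem Γ 𝒜)

/-- Isotony is not an axiom: a is the image of a ⊗ 1 in 𝒜(I) ⊗ 𝒜(J \ I). -/
theorem loc_mono {I J : Finset Γ} (h : I ⊆ J) : S.loc I ≤ S.loc J := by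
  intro a ha
  obtain ⟨e, he⟩ := S.tensor I (J \ I) Finset.disjoint_sdiff
  have : (e (⟨a, ha⟩ ⊗ₜ 1) : 𝒜) = a := by simp [he]
  have h2 : a ∈ S.loc (I ∪ (J \ I)) := by
    rw [← this]; exact SetLike.coe_mem _
  rwa [Finset.union_sdiff_of_subset h] at h2

theorem commute_loc {I J : Finset Γ} (h : Disjoint I J) {a b : 𝒜} (ha : a ∈ S.loc I)
    (hb : b ∈ S.loc J) : Commute a b := by
  obtain ⟨e, he⟩ := S.tensor I J h
  have h1 := he ⟨a, ha⟩ 1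
  have h2 := he 1 ⟨b, hb⟩
  have h3 := he ⟨a, ha⟩ ⟨b, hb⟩
  simp only [OneMemClass.coe_one, mul_one, one_mul] at h1 h2 h3
  have h4 : e (⟨a, ha⟩ ⊗ₜ 1) * e (1 ⊗ₜ ⟨b, hb⟩) = e (1 ⊗ₜ ⟨b, hb⟩) * e (⟨a, ha⟩ ⊗ₜ 1) := by
    rw [← map_mul, ← map_mul, Algebra.TensorProduct.tmul_mul_tmul,
      Algebra.TensorProduct.tmul_mul_tmul]
    simp
  have h5 := congrArg (Subtype.val) h4
  simp only [MulMemClass.coe_mul, h1, h2] at h5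
  exact h5

theorem loc_subset_region {I : Finset Γ} {J : Set Γ} (h : (I : Set Γ) ⊆ J) :
    (S.loc I : Set 𝒜) ⊆ S.region J :=
  (Set.subset_iUnion₂ (s := fun (Λ : Finset Γ) (_ : (Λ : Set Γ) ⊆ J) => (S.loc Λ : Set 𝒜))
    I h).trans subset_closure

theorem commute_region {I : Finset Γ} {a b : 𝒜} (ha : a ∈ S.loc I)
    (hb : b ∈ S.region (I : Set Γ)ᶜ) : Commute a b := by
  have hcl : IsClosed {b : 𝒜 | a * b = b * a} :=
    isClosed_eq (continuous_const_mul a) (continuous_mul_const a)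
  refine closure_minimal ?_ hcl hb
  intro c hc
  simp only [Set.mem_iUnion] at hc
  obtain ⟨Λ, hΛ, hc⟩ := hc
  refine S.commute_loc ?_ ha hc
  rw [← Finset.disjoint_coe]
  exact (Set.disjoint_left.2 fun x hx hx' => hΛ hx' hx)

/-- The identification of a full matrix algebra with a local algebra, as a map into `𝒜`. -/
def emb (I : Finset Γ) : Matrix (Fin (S.dim I)) (Fin (S.dim I)) ℂ →⋆ₐ[ℂ] 𝒜 :=
  (S.loc I).subtype.comp ((S.iso I).symm : _ →⋆ₐ[ℂ] S.loc I)

theorem emb_apply (I : Finset Γ) (X : Matrix (Fin (S.dim I)) (Fin (S.dim I)) ℂ) :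
    S.emb I X = ((S.iso I).symm X : 𝒜) := rfl

theorem emb_mem (I : Finset Γ) (X : Matrix (Fin (S.dim I)) (Fin (S.dim I)) ℂ) :
    S.emb I X ∈ S.loc I := SetLike.coe_mem ((S.iso I).symm X)

theorem exists_emb {I : Finset Γ} {a : 𝒜} (ha : a ∈ S.loc I) : ∃ X, S.emb I X = a :=
  ⟨S.iso I ⟨a, ha⟩, by simp [emb_apply]⟩

theorem emb_injective (I : Finset Γ) : Function.Injective (S.emb I) :=
  Subtype.val_injective.comp (S.iso I).symm.injective

theorem dim_pos [Nontrivial 𝒜] (I : Finset Γ) : 0 < S.dim I := by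
  by_contra h
  have h0 : S.dim I = 0 := by omega
  have : Subsingleton (Matrix (Fin (S.dim I)) (Fin (S.dim I)) ℂ) := by
    rw [h0]; infer_instance
  exact one_ne_zero (α := 𝒜) (by
    rw [← map_one (S.emb I), Subsingleton.elim (1 : Matrix (Fin (S.dim I)) _ ℂ) 0, map_zero])

instance (I : Finset Γ) : FiniteDimensional ℂ (S.loc I) :=
  Module.Finite.equiv (S.iso I).symm.toAlgEquiv.toLinearEquiv

theorem finrank_loc (I : Finset Γ) : Module.finrank ℂ (S.loc I) = S.dim I * S.dim I := by
  rw [(S.iso I).toAlgEquiv.toLinearEquiv.finrank_eq, Module.finrank_matrix]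
  simp

theorem dim_union {I J : Finset Γ} (h : Disjoint I J) : S.dim (I ∪ J) = S.dim I * S.dim J := by
  obtain ⟨e, -⟩ := S.tensor I J h
  have := e.toLinearEquiv.finrank_eq
  rw [Module.finrank_tensorProduct, finrank_loc, finrank_loc, finrank_loc] at this
  exact Nat.mul_self_inj.1 (by rw [← this]; ring)

theorem dim_empty [Nontrivial 𝒜] : S.dim ∅ = 1 := by
  have h := S.dim_union (Finset.disjoint_empty_left ∅)
  have := S.dim_pos ∅
  rw [Finset.empty_union] at h
  nlinarith

/-- The inclusion of local algebras in terms of matrices. -/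
def incl {I J : Finset Γ} (h : I ⊆ J) : Matrix (Fin (S.dim I)) (Fin (S.dim I)) ℂ →⋆ₐ[ℂ]
    Matrix (Fin (S.dim J)) (Fin (S.dim J)) ℂ :=
  ((S.iso J : S.loc J →⋆ₐ[ℂ] _).comp (StarSubalgebra.inclusion (S.loc_mono h))).comp
    ((S.iso I).symm : _ →⋆ₐ[ℂ] S.loc I)

theorem emb_incl {I J : Finset Γ} (h : I ⊆ J) (X : Matrix (Fin (S.dim I)) (Fin (S.dim I)) ℂ) :
    S.emb J (S.incl h X) = S.emb I X := by
  simp [emb_apply, incl]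

/-! ### Density matrices and the product state. -/

variable (φ : CStarState 𝒜)

theorem _root_.CStarState.nontrivial {𝒜 : Type*} [CStarAlgebra 𝒜] (φ : CStarState 𝒜) :
    Nontrivial 𝒜 := by
  refine ⟨⟨1, 0, fun h => ?_⟩⟩
  have := φ.map_one
  rw [h, map_zero] at this
  exact zero_ne_one this

theorem trace_densityMatrix_mul (I : Finset Γ) (X : Matrix (Fin (S.dim I)) (Fin (S.dim I)) ℂ) :
    (S.densityMatrix φ I * X).trace = φ (S.emb I X) := by
  conv_rhs => rw [X.matrix_eq_sum_single]
  simp only [map_sum]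
  have h (i j : Fin (S.dim I)) : φ (S.emb I (Matrix.single i j (X i j))) = X i j * S.densityMatrix φ I j i := by
    have h : Matrix.single i j (X i j) = X i j • Matrix.single i j (1 : ℂ) := by simp
    rw [h, map_smul, map_smul, smul_eq_mul]; rfl
  simp only [h, Matrix.trace, Matrix.diag, Matrix.mul_apply]
  rw [Finset.sum_comm]
  exact Finset.sum_congr rfl fun i _ => Finset.sum_congr rfl fun j _ => mul_comm _ _

theorem densityMatrix_eq_of_forall (I : Finset Γ) {D : Matrix (Fin (S.dim I)) (Fin (S.dim I)) ℂ}
    (h : ∀ X, (D * X).trace = φ (S.emb I X)) : S.densityMatrix φ I = D :=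
  Matrix.ext_iff_trace_mul_right.2 fun X => by rw [h, trace_densityMatrix_mul]

theorem trace_densityMatrix (I : Finset Γ) : (S.densityMatrix φ I).trace = 1 := by
  rw [← mul_one (S.densityMatrix φ I), trace_densityMatrix_mul, map_one, φ.map_one]

theorem posSemidef_densityMatrix (I : Finset Γ) : (S.densityMatrix φ I).PosSemidef := by
  refine Matrix.PosSemidef.of_dotProduct_mulVec_nonneg ?_ fun x => ?_
  · ext i j
    simp only [Matrix.conjTranspose_apply, densityMatrix, Matrix.of_apply, ← φ.apply_star]
    rw [← emb_apply, ← map_star, Matrix.star_eq_conjTranspose]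
    simp [emb_apply]
  · have h : star x ⬝ᵥ (S.densityMatrix φ I).mulVec x
        = (S.densityMatrix φ I * Matrix.vecMulVec x (star x)).trace := by
      rw [Matrix.mul_vecMulVec, Matrix.trace_vecMulVec, dotProduct_comm]
    obtain ⟨B, hB⟩ := (Matrix.posSemidef_vecMulVec_self_star x).exists_eq_star_mul_self
    rw [h, trace_densityMatrix_mul, hB, map_mul, map_star]
    exact φ.nonneg _

/-- With D = C* C the density matrix on A and W_km = E_km C, the map Z ↦ ∑ W_km Z W_km* sends X ∈
𝒜(A) to Tr(DX)1 and pulls out factors from 𝒜(Aᶜ), which commute with each W_km. Composing with φ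
gives the product formula, and the form of the sum makes positivity evident. -/
theorem exists_productState (A : Finset Γ) : ∃ ω, S.IsProductState φ A ω := by
  obtain ⟨C, hC⟩ := (S.posSemidef_densityMatrix φ A).exists_eq_star_mul_self
  let W (k m : Fin (S.dim A)) : Matrix (Fin (S.dim A)) (Fin (S.dim A)) ℂ :=
    Matrix.single k m 1 * C
  have hWW (X : Matrix (Fin (S.dim A)) (Fin (S.dim A)) ℂ) :
      ∑ k, ∑ m, W k m * X * star (W k m) = (S.densityMatrix φ A * X).trace • 1 := by
    have h (k m : Fin (S.dim A)) :
        W k m * X * star (W k m) = Matrix.single k k ((C * X * star C) m m) := by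
      calc _ = Matrix.single k m 1 * (C * X * star C) * Matrix.single m k 1 := by
            simp only [W, star_mul, Matrix.star_eq_conjTranspose, Matrix.conjTranspose_single,
              star_one, mul_assoc]
        _ = _ := by rw [Matrix.single_mul_mul_single, one_mul, mul_one]
    have h2 (k : Fin (S.dim A)) : ∑ m, W k m * X * star (W k m)
        = Matrix.single k k (C * X * star C).trace := by
      simp only [h, Matrix.trace, Matrix.diag]
      exact (map_sum (Matrix.singleAddMonoidHom (α := ℂ) k k) _ _).symm
    simp only [h2]
    rw [Matrix.sum_single_eq_diagonal, hC, mul_assoc (star C) C X,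
      Matrix.trace_mul_comm (star C), ← Matrix.smul_one_eq_diagonal]
  let f : 𝒜 →ₗ[ℂ] ℂ := ∑ k, ∑ m, φ.toLinearMap.comp
    ((LinearMap.mulLeft ℂ (S.emb A (W k m))).comp (LinearMap.mulRight ℂ (star (S.emb A (W k m)))))
  have hf (Z : 𝒜) : f Z = ∑ k, ∑ m, φ (S.emb A (W k m) * Z * star (S.emb A (W k m))) := by
    simp [f, LinearMap.sum_apply, mul_assoc]
  have hprod : ∀ X ∈ S.loc A, ∀ Y ∈ S.region (A : Set Γ)ᶜ, f (X * Y) = φ X * φ Y := by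
    intro X hX Y hY
    obtain ⟨X, rfl⟩ := S.exists_emb hX
    have h1 (k m) : S.emb A (W k m) * (S.emb A X * Y) * star (S.emb A (W k m))
        = S.emb A (W k m * X * star (W k m)) * Y := by
      have hcY := (S.commute_region (S.emb_mem A (star (W k m))) hY).eq
      rw [← map_star, map_mul _ (W k m * X), map_mul _ (W k m), mul_assoc _ _ Y, hcY]
      simp only [mul_assoc]
    simp only [hf, h1, ← map_sum, ← Finset.sum_mul, hWW]
    rw [map_smul, map_one, smul_mul_assoc, one_mul, map_smul, trace_densityMatrix_mul, smul_eq_mul]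
  have h1 : (1 : 𝒜) ∈ S.region (A : Set Γ)ᶜ :=
    S.loc_subset_region (I := ∅) (by simp) (one_mem _)
  refine ⟨⟨f, fun a => ?_, ?_⟩, hprod⟩
  · rw [hf]
    refine Finset.sum_nonneg fun k _ => Finset.sum_nonneg fun m _ => ?_
    have := φ.nonneg (a * star (S.emb A (W k m)))
    simpa [mul_assoc] using this
  · simpa [φ.map_one] using hprod 1 (one_mem _) 1 h1

variable {φ} {A : Finset Γ} {ω : CStarState 𝒜}

theorem IsProductState.apply_loc (h : S.IsProductState φ A ω) {X : 𝒜} (hX : X ∈ S.loc A) :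
    ω X = φ X := by
  have := h X hX 1 (S.loc_subset_region (I := ∅) (by simp) (one_mem _))
  rwa [mul_one, φ.map_one, mul_one] at this

theorem IsProductState.apply_region (h : S.IsProductState φ A ω) {Y : 𝒜}
    (hY : Y ∈ S.region (A : Set Γ)ᶜ) : ω Y = φ Y := by
  have := h 1 (one_mem _) Y hY
  rwa [one_mul, φ.map_one, one_mul] at this

/-- Induction principle for the algebra of a union of disjoint finite regions. -/
theorem loc_union_induction {I J : Finset Γ} (h : Disjoint I J) {p : 𝒜 → Prop} (h0 : p 0)
    (hmul : ∀ a ∈ S.loc I, ∀ b ∈ S.loc J, p (a * b)) (hadd : ∀ a b, p a → p b → p (a + b))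
    {a : 𝒜} (ha : a ∈ S.loc (I ∪ J)) : p a := by
  obtain ⟨e, he⟩ := S.tensor I J h
  obtain ⟨t, ht⟩ := e.surjective ⟨a, ha⟩
  suffices H : ∀ t, p (e t : 𝒜) by simpa [ht] using H t
  intro t
  induction t with
  | zero => simpa using h0
  | tmul x y => rw [he]; exact hmul _ x.2 _ y.2
  | add x y hx hy => rw [map_add]; exact hadd _ _ hx hy

/-- Products XY span each 𝒜(A ∪ (I \ A)), and these algebras are jointly dense. -/
theorem IsProductState.eq {ω' : CStarState 𝒜} (h : S.IsProductState φ A ω)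
    (h' : S.IsProductState φ A ω') : ω = ω' := by
  refine CStarState.ext_of_dense S.dense fun a ha => ?_
  obtain ⟨I, ha⟩ := Set.mem_iUnion.1 ha
  have ha' : a ∈ S.loc (A ∪ (I \ A)) :=
    S.loc_mono (by simp) ha
  refine S.loc_union_induction (p := fun a => ω a = ω' a) Finset.disjoint_sdiff (by simp)
    (fun x hx y hy => ?_) (fun x y hx hy => ?_) ha'
  · have hy' : y ∈ S.region (A : Set Γ)ᶜ :=
      S.loc_subset_region (fun i hi => by simp at hi; simp [hi.2]) hy
    rw [h x hx y hy', h' x hx y hy']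
  · simp only [map_add, hx, hy]

/-! ### Entropies of φ and of the product state. -/

theorem entropy_congr {ψ : CStarState 𝒜} {I : Finset Γ} (h : ∀ X ∈ S.loc I, ψ X = φ X) :
    S.entropy ψ I = S.entropy φ I := by
  have : S.densityMatrix ψ I = S.densityMatrix φ I :=
    S.densityMatrix_eq_of_forall ψ I fun X => by
      rw [trace_densityMatrix_mul, h _ (S.emb_mem I X)]
  rw [entropy, entropy, this]

theorem entropy_empty : S.entropy φ ∅ = 0 := by
  have := φ.nontrivial
  have : S.densityMatrix φ ∅ = 1 := by
    have h1 := S.trace_densityMatrix φ ∅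
    have : Unique (Fin (S.dim ∅)) := by rw [S.dim_empty]; infer_instance
    ext i j
    rw [Subsingleton.elim i default, Subsingleton.elim j default]
    simpa [Matrix.trace] using h1
  rw [entropy, this, cfc_apply_one]
  simp

theorem IsProductState.entropy_union (h : S.IsProductState φ A ω) {Λ : Finset Γ}
    (hΛ : (Λ : Set Γ) ⊆ (A : Set Γ)ᶜ) :
    S.entropy ω (A ∪ Λ) = S.entropy φ A + S.entropy ω Λ := by
  have := φ.nontrivial
  have hd : Disjoint A Λ := by
    rw [← Finset.disjoint_coe]
    exact (Set.disjoint_left.2 fun x hx hx' => hΛ hx' hx)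
  have : NeZero (S.dim A) := ⟨(S.dim_pos A).ne'⟩
  have : NeZero (S.dim Λ) := ⟨(S.dim_pos Λ).ne'⟩
  set ι := S.incl (Finset.subset_union_left (s₁ := A) (s₂ := Λ))
  set κ := S.incl (Finset.subset_union_right (s₁ := A) (s₂ := Λ))
  have hι (X) : S.emb (A ∪ Λ) (ι X) = S.emb A X := S.emb_incl _ X
  have hκ (X) : S.emb (A ∪ Λ) (κ X) = S.emb Λ X := S.emb_incl _ X
  have hc (X Y) : Commute (ι X) (κ Y) := by
    apply S.emb_injective (A ∪ Λ)
    rw [map_mul, map_mul, hι, hκ]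
    exact S.commute_loc hd (S.emb_mem A X) (S.emb_mem Λ Y)
  have hk : Fintype.card (Fin (S.dim (A ∪ Λ)))
      = Fintype.card (Fin (S.dim A)) * Fintype.card (Fin (S.dim Λ)) := by
    simpa using S.dim_union hd
  have hD : S.densityMatrix ω (A ∪ Λ) = ι (S.densityMatrix φ A) * κ (S.densityMatrix ω Λ) := by
    refine S.densityMatrix_eq_of_forall ω _ fun Z => ?_
    -- The induction runs over elements of 𝒜, so the matrix is existentially quantified and
    -- recovered by injectivity of `emb`.
    suffices H : ∃ Z', S.emb (A ∪ Λ) Z' = S.emb (A ∪ Λ) Z ∧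
        (ι (S.densityMatrix φ A) * κ (S.densityMatrix ω Λ) * Z').trace = ω (S.emb (A ∪ Λ) Z) by
      obtain ⟨Z', hZ, h⟩ := H
      rwa [S.emb_injective _ hZ] at h
    refine S.loc_union_induction (p := fun a => ∃ Z', S.emb (A ∪ Λ) Z' = a ∧
      (ι (S.densityMatrix φ A) * κ (S.densityMatrix ω Λ) * Z').trace = ω a) hd
      ⟨0, by simp⟩ ?_ ?_ (S.emb_mem _ Z)
    · intro x hx y hy
      obtain ⟨X, rfl⟩ := S.exists_emb hx
      obtain ⟨Y, rfl⟩ := S.exists_emb hy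
      refine ⟨ι X * κ Y, by rw [map_mul, hι, hκ], ?_⟩
      rw [Commute.mul_mul_mul_comm (hc _ _).symm, ← map_mul, ← map_mul,
        Matrix.trace_mul_of_commute ι κ hc hk,
        trace_densityMatrix_mul, trace_densityMatrix_mul,
        h _ hx _ (S.loc_subset_region hΛ hy), h.apply_region S (S.loc_subset_region hΛ hy)]
    · rintro _ _ ⟨X, rfl, hX⟩ ⟨Y, rfl, hY⟩
      exact ⟨X + Y, map_add _ _ _, by rw [mul_add, Matrix.trace_add, hX, hY, map_add]⟩
  rw [entropy, entropy, entropy, hD, Matrix.trace_cfc_negMulLog_mul ι κ hc hk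
    (S.posSemidef_densityMatrix φ A).1 (S.posSemidef_densityMatrix ω Λ).1
    (S.trace_densityMatrix φ A) (S.trace_densityMatrix ω Λ), Complex.add_re]

theorem IsProductState.le_condEntropy (h : S.IsProductState φ A ω) :
    (S.entropy φ A : EReal) ≤ S.condEntropy ω A (A : Set Γ)ᶜ := by
  refine le_iInf₂ fun Λ hΛ => ?_
  rw [h.entropy_union S hΛ, add_sub_cancel_right]

theorem condEntropy_anti (A : Finset Γ) {B C : Set Γ} (h : B ⊆ C) :
    S.condEntropy φ A C ≤ S.condEntropy φ A B :=
  le_iInf₂ fun Λ hΛ => iInf₂_le Λ (hΛ.trans h)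

theorem mutualEntropy_mono (A : Finset Γ) {B C : Set Γ} (h : B ⊆ C) :
    S.mutualEntropy φ A B ≤ S.mutualEntropy φ A C :=
  EReal.sub_le_sub le_rfl (S.condEntropy_anti A h)

/-- This is the term Λ = ∅ of the infimum. -/
theorem condEntropy_le_entropy (A : Finset Γ) (B : Set Γ) :
    S.condEntropy φ A B ≤ S.entropy φ A := by
  refine (iInf₂_le ∅ (by simp)).trans ?_
  rw [Finset.union_empty, entropy_empty, sub_zero]

theorem mutualEntropy_nonneg (A : Finset Γ) (B : Set Γ) : 0 ≤ S.mutualEntropy φ A B := by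
  have h := S.condEntropy_le_entropy (φ := φ) A B
  exact (EReal.sub_nonneg (by simp) (by simp)).2 h

/-! ### The stability estimate and the area law. -/

theorem innerHamiltonian_mem (Φ : S.Potential) (I : Finset Γ) :
    Φ.innerHamiltonian I ∈ S.loc I :=
  sum_mem fun K hK => S.loc_mono (Finset.mem_powerset.1 hK) (Φ.mem_loc K)

theorem IsLTS.mutualEntropy_le {Φ : S.Potential} {Hsurf : Finset Γ → 𝒜} {β : ℝ} (hβ : 0 < β)
    (hφ : S.IsLTS Φ Hsurf β φ) (h : S.IsProductState φ A ω) :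
    S.mutualEntropy φ A (A : Set Γ)ᶜ ≤ ((β * (ω (Hsurf A) - φ (Hsurf A)).re : ℝ) : EReal) := by
  have h1 := hφ A ω fun X hX => h.apply_region S hX
  have h2 := h.le_condEntropy S
  have h3 := S.condEntropy_le_entropy (φ := φ) A (A : Set Γ)ᶜ
  have h4 := S.condEntropy_le_entropy (φ := ω) A (A : Set Γ)ᶜ
  rw [condFreeEnergy, condFreeEnergy] at h1
  rw [mutualEntropy]
  have hH := h.apply_loc S (S.innerHamiltonian_mem Φ A)
  rw [S.entropy_congr (fun X hX => h.apply_loc S hX)] at h4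
  -- The conditional entropy of ω is exactly S_A(φ), so its free energy is finite.
  rw [le_antisymm h4 h2, ← EReal.coe_mul, ← EReal.coe_sub] at h1
  have hβ' : (0 : ℝ) < 1 / β := by positivity
  generalize S.condEntropy φ A (A : Set Γ)ᶜ = s at h1 h3
  induction s with
  -- Conditional entropy -∞ would give φ infinite free energy, above the finite value at ω;
  -- stability excludes this.
  | bot =>
    rw [EReal.coe_mul_bot_of_pos hβ', EReal.coe_sub_bot] at h1
    exact absurd (top_le_iff.1 h1) (EReal.coe_ne_top _)
  | top => simp at h3
  | coe s =>
    norm_cast at h1 ⊢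
    simp only [map_add, Complex.add_re, Complex.sub_re, hH] at h1 ⊢
    have := mul_le_mul_of_nonneg_left h1 hβ.le
    field_simp at this
    linarith

theorem re_sub_apply_le (ψ φ : CStarState 𝒜) (a : 𝒜) : (ψ a - φ a).re ≤ 2 * ‖a‖ := by
  have h1 := (Complex.re_le_norm (ψ a - φ a)).trans (norm_sub_le _ _)
  linarith [ψ.norm_apply_le a, φ.norm_apply_le a]

end QuantumSpinSystem

theorem theorem1 {Γ : Type*} [DecidableEq Γ] {𝒜 : Type*} [CStarAlgebra 𝒜]
    (S : QuantumSpinSystem Γ 𝒜) (Φ : S.Potential) (Hsurf : Finset Γ → 𝒜)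
    (hsurf : ∀ I : Finset Γ, Φ.HasSurfaceEnergy I (Hsurf I))
    (β : ℝ) (hβ : 0 < β) (φ : CStarState 𝒜) (hφ : S.IsLTS Φ Hsurf β φ) :
    (∀ A : Finset Γ, ∃! ω : CStarState 𝒜, S.IsProductState φ A ω) ∧
    (∀ (A : Finset Γ) (ω : CStarState 𝒜), S.IsProductState φ A ω →
      (∀ B : Set Γ, B ⊆ (A : Set Γ)ᶜ →
        S.mutualEntropy φ A B ≤ S.mutualEntropy φ A (A : Set Γ)ᶜ) ∧
      S.mutualEntropy φ A (A : Set Γ)ᶜ ≤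
        ((β * (ω (Hsurf A) - φ (Hsurf A)).re : ℝ) : EReal) ∧
      β * (ω (Hsurf A) - φ (Hsurf A)).re ≤ 2 * β * ‖Hsurf A‖) ∧
    (∀ (ν : ℕ), 0 < ν → ∀ (e : Γ ≃ (Fin ν → ℤ)) (l : Filter (Finset Γ)), IsVanHove e l →
      Tendsto (fun A : Finset Γ => ‖Hsurf A‖ / (A.card : ℝ)) l (𝓝 0) →
      Tendsto (fun A : Finset Γ =>
        S.mutualEntropy φ A (A : Set Γ)ᶜ / ((A.card : ℝ) : EReal)) l (𝓝 0)) := by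

  have bound (A : Finset Γ) (ω : CStarState 𝒜) :
      β * (ω (Hsurf A) - φ (Hsurf A)).re ≤ 2 * β * ‖Hsurf A‖ := by
    nlinarith [QuantumSpinSystem.re_sub_apply_le ω φ (Hsurf A)]
  refine ⟨fun A => ?_, fun A ω h => ⟨fun B hB => S.mutualEntropy_mono A hB,
    QuantumSpinSystem.IsLTS.mutualEntropy_le S hβ hφ h, bound A ω⟩, fun ν _ e l _ hl => ?_⟩
  · obtain ⟨ω, h⟩ := S.exists_productState φ A
    exact ⟨ω, h, fun ω' h' => QuantumSpinSystem.IsProductState.eq S h' h⟩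
  · have hl' : Tendsto (fun A : Finset Γ => ((2 * β * (‖Hsurf A‖ / (A.card : ℝ)) : ℝ) : EReal))
        l (𝓝 0) := by
      rw [← EReal.coe_zero, EReal.tendsto_coe]
      simpa using hl.const_mul (2 * β)
    -- The density lies between 0 and 2β‖H_∂A‖/|A| for every A.
    refine tendsto_of_tendsto_of_tendsto_of_le_of_le tendsto_const_nhds hl' (fun A => ?_)
      fun A => ?_
    · exact EReal.div_nonneg (S.mutualEntropy_nonneg A _) (by positivity)
    · obtain ⟨ω, h⟩ := S.exists_productState φ A
      have h1 := (QuantumSpinSystem.IsLTS.mutualEntropy_le S hβ hφ h).trans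
        (EReal.coe_le_coe_iff.2 (bound A ω))
      have h2 := EReal.div_le_div_right_of_nonneg (c := ((A.card : ℝ) : EReal)) (by positivity) h1
      rwa [← EReal.coe_div, mul_div_assoc] at h2
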